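/- Let $Q_n$ be the $n$-dimensional hypercube, whose vertices are the binary strings of length $n$, two strings being adjacent when they differ in exactly one position. The $n$-dimensional folded hypercube $FQ_n$ is obtained from $Q_n$ by adding an edge between every pair of complementary strings (strings that differ in every position). For a finite graph $G$ and a positive integer $g$, a $g$-component cut of $G$ is a set $F$ of vertices such that $G-F$ has at least $g$ connected components, and the $g$-component connectivity $c\kappa_g(G)$ is the size of a smallest $g$-component cut of $G$. Put $$f_n(g)=g(n+1)-\tfrac12 g(g+1)+1 .$$ Then for every integer $n\ge 6$, the graph $FQ_n$ has an $(n+3)$-component cut and $$c\kappa_{n+3}(FQ_n)>f_n(n+2).$$ (In particular the formula $c\kappa_{g+1}(FQ_n)=f_n(g)$ fails for $g=n+2$.) -/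

import Mathlib

/-- The `n`-dimensional hypercube `Q_n`: the vertices are the binary strings of length `n`, and two
strings are adjacent when they differ in exactly one position. -/
def hypercube (n : ℕ) : SimpleGraph (Fin n → Bool) where
  Adj u v := hammingDist u v = 1
  symm := ⟨fun u v h => by rwa [hammingDist_comm]⟩
  loopless := ⟨fun u h => by simp at h⟩

/-- The complement of a binary string (every bit is flipped). -/
def complementString {n : ℕ} (u : Fin n → Bool) : Fin n → Bool := fun i => !(u i)

/-- The `n`-dimensional folded hypercube `FQ_n`: the hypercube `Q_n` together with an edge between
any two complementary strings. -/
def foldedHypercube (n : ℕ) : SimpleGraph (Fin n → Bool) :=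
  hypercube n ⊔ SimpleGraph.fromRel (fun u v => v = complementString u)

/-- `F` is a `g`-component cut of `G`: deleting the vertices of `F` leaves a graph with at least
`g` connected components. -/
def IsComponentCut {V : Type*} [Fintype V] (G : SimpleGraph V) (g : ℕ) (F : Finset V) : Prop :=
  g ≤ Nat.card (G.induce {v | v ∉ F}).ConnectedComponent

/-- The `g`-component connectivity of `G`: the size of a smallest `g`-component cut of `G`.
(If `G` has no `g`-component cut the value is `0`, so that a lower bound `k < componentConnectivity G g` also says that
such a cut exists.) -/
noncomputable def componentConnectivity {V : Type*} [Fintype V] (G : SimpleGraph V) (g : ℕ) : ℕ :=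
  sInf {k : ℕ | ∃ F : Finset V, IsComponentCut G g F ∧ F.card = k}

/-- `f_n(g) = g (n + 1) - g (g + 1) / 2 + 1`. -/
def fFormula (n g : ℕ) : ℚ := (g : ℚ) * (n + 1) - (g : ℚ) * (g + 1) / 2 + 1

/-! Since `2 * f_n(n+2) = n(n+1)`, the claim is that `n+3` components force more than `n(n+1)/2`
deleted vertices. Each surviving vertex is labelled by its component, and partial labellings
constant along surviving edges are studied instead of cuts; these restrict well to subcubes.

The edges of `FQ_n` form `n+1` perfect matchings: the `n` bit flips and the complement map. Omitting
any two leaves two copies of `Q_m`, `m = n-1`, in which every vertex has two neighbours in the other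
copy. Two facts about `Q_m` are proved by induction on `m`: `c+1` classes cost at least `cm -
c(c+1)/2 + 1` vertices (`Compat.deleted_lower_bound`), and more than `m` classes at the minimal cost
`m(m-1)/2 + 1` force exactly `m+1` classes and deleted vertices of one parity (`Compat.tight`).

If both copies meet at least four classes, adding the two bounds suffices, except for a tie at `m =
5` which parity excludes (`Cross.folded_lower_bound`). If one copy meets at most three, then at
least `m+1` classes avoid it, and all neighbours of their representatives in that copy are deleted.
There are at least `2m` of these if few representatives share neighbours; the other copy is then too
cheap for its `m+2` classes, by `Compat.tight`. A suitable pair of matchings exists by averaging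
over all `n(n+1)/2` pairs (`exists_split`), and automorphisms of `FQ_n` move it to standard
position. -/

set_option linter.unusedSectionVars false

/-! ### Partial labellings of the cube and the basic lower bound -/

section Labellings

variable {m : ℕ} {α : Type*} [DecidableEq α]

/-- The string `v` with its `i`-th bit flipped. -/
def flipAt (i : Fin m) (v : Fin m → Bool) : Fin m → Bool := Function.update v i (!v i)

/-- A partial labelling of the vertices of the hypercube (`none` marks a deleted vertex) in which
adjacent vertices that are not deleted carry the same label. -/
def Compat (l : (Fin m → Bool) → Option α) : Prop :=
  ∀ v i, l v = none ∨ l (flipAt i v) = none ∨ l v = l (flipAt i v)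

/-- Two partial labellings agree wherever both are defined. -/
def Cross (l₀ l₁ : (Fin m → Bool) → Option α) : Prop :=
  ∀ v, l₀ v = none ∨ l₁ v = none ∨ l₀ v = l₁ v

/-- The deleted vertices of a partial labelling. -/
def deleted (l : (Fin m → Bool) → Option α) : Finset (Fin m → Bool) :=
  Finset.univ.filter fun v => l v = none

/-- The labels that a partial labelling uses. -/
def labels (l : (Fin m → Bool) → Option α) : Finset α := Finset.eraseNone (Finset.univ.image l)

/-- The restriction of a labelling to the strings with first bit `b`. -/
def half (b : Bool) (l : (Fin (m + 1) → Bool) → Option α) : (Fin m → Bool) → Option α :=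
  fun v => l (Fin.cons b v)

lemma mem_deleted {l : (Fin m → Bool) → Option α} {v : Fin m → Bool} :
    v ∈ deleted l ↔ l v = none := by
  simp [deleted]

lemma mem_labels {l : (Fin m → Bool) → Option α} {a : α} :
    a ∈ labels l ↔ ∃ v, l v = some a := by
  simp [labels]

lemma flipAt_flipAt (i : Fin m) (v : Fin m → Bool) : flipAt i (flipAt i v) = v := by
  simp [flipAt]

lemma flipAt_zero_cons (b : Bool) (v : Fin m → Bool) :
    flipAt 0 (Fin.cons b v : Fin (m + 1) → Bool) = Fin.cons (!b) v := by
  simp [flipAt, Fin.update_cons_zero]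

lemma flipAt_succ_cons (b : Bool) (v : Fin m → Bool) (i : Fin m) :
    flipAt i.succ (Fin.cons b v : Fin (m + 1) → Bool) = Fin.cons b (flipAt i v) := by
  simp [flipAt, Fin.cons_update]

lemma complementString_cons (b : Bool) (v : Fin m → Bool) :
    complementString (Fin.cons b v : Fin (m + 1) → Bool) = Fin.cons (!b) (complementString v) := by
  funext i
  refine Fin.cases ?_ (fun j => ?_) i <;> simp [complementString]

lemma complementString_involutive :
    Function.Involutive (complementString : (Fin m → Bool) → Fin m → Bool) := by
  intro v; funext i; simp [complementString]

lemma Cross.symm {l₀ l₁ : (Fin m → Bool) → Option α} (h : Cross l₀ l₁) : Cross l₁ l₀ := by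
  intro v
  rcases h v with h | h | h
  · exact Or.inr (Or.inl h)
  · exact Or.inl h
  · exact Or.inr (Or.inr h.symm)

lemma Compat.restrict {l : (Fin (m + 1) → Bool) → Option α} (h : Compat l) (b : Bool) :
    Compat (half b l) := by
  intro v i
  have := h (Fin.cons b v) i.succ
  rwa [flipAt_succ_cons] at this

lemma Compat.cross {l : (Fin (m + 1) → Bool) → Option α} (h : Compat l) :
    Cross (half false l) (half true l) := by
  intro v
  have := h (Fin.cons false v) 0
  rwa [flipAt_zero_cons] at this

lemma card_deleted_eq (l : (Fin (m + 1) → Bool) → Option α) :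
    (deleted l).card = (deleted (half false l)).card + (deleted (half true l)).card := by
  have hc (b : Bool) : Function.Injective (fun v : Fin m → Bool => (Fin.cons b v : Fin (m + 1) → Bool)) :=
    Fin.cons_right_injective (α := fun _ => Bool) b
  rw [← Finset.card_image_of_injective (deleted (half false l)) (hc false),
    ← Finset.card_image_of_injective (deleted (half true l)) (hc true),
    ← Finset.card_union_of_disjoint]
  · congr 1
    ext v
    simp only [Finset.mem_union, Finset.mem_image, mem_deleted]
    constructor
    · intro hv
      rcases hb : v 0 with _ | _
      · exact Or.inl ⟨Fin.tail v, by simpa [half, ← hb] using hv, by simp [← hb]⟩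
      · exact Or.inr ⟨Fin.tail v, by simpa [half, ← hb] using hv, by simp [← hb]⟩
    · rintro (⟨w, hw, rfl⟩ | ⟨w, hw, rfl⟩) <;> exact hw
  · rw [Finset.disjoint_left]
    intro v h₀ h₁
    obtain ⟨w, -, rfl⟩ := Finset.mem_image.1 h₀
    obtain ⟨w', -, h⟩ := Finset.mem_image.1 h₁
    simpa using congrFun h 0

lemma labels_eq (l : (Fin (m + 1) → Bool) → Option α) :
    labels l = labels (half false l) ∪ labels (half true l) := by
  ext a
  simp only [Finset.mem_union, mem_labels]
  constructor
  · rintro ⟨v, hv⟩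
    rcases hb : v 0 with _ | _
    · exact Or.inl ⟨Fin.tail v, by simpa [half, ← hb] using hv⟩
    · exact Or.inr ⟨Fin.tail v, by simpa [half, ← hb] using hv⟩
  · rintro (⟨w, hw⟩ | ⟨w, hw⟩) <;> exact ⟨_, hw⟩

/-- A vertex whose label does not occur in the other labelling is deleted there. -/
lemma Cross.eq_none {l₀ l₁ : (Fin m → Bool) → Option α} (h : Cross l₀ l₁) {v : Fin m → Bool}
    {a : α} (hv : l₀ v = some a) (ha : a ∉ labels l₁) : l₁ v = none := by
  rcases h v with h | h | h
  · simp [h] at hv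
  · exact h
  · exact absurd (mem_labels.2 ⟨v, h ▸ hv⟩) ha

/-- Without a common label, no vertex can survive in both labellings. -/
lemma Cross.two_pow_le {l₀ l₁ : (Fin m → Bool) → Option α} (h : Cross l₀ l₁)
    (hd : Disjoint (labels l₀) (labels l₁)) :
    2 ^ m ≤ (deleted l₀).card + (deleted l₁).card := by
  have hu : (Finset.univ : Finset (Fin m → Bool)) ⊆ deleted l₀ ∪ deleted l₁ := by
    intro v _
    rw [Finset.mem_union, mem_deleted, mem_deleted]
    rcases hv : l₀ v with _ | a
    · exact Or.inl rfl
    · exact Or.inr (h.eq_none hv (Finset.disjoint_left.1 hd (mem_labels.2 ⟨v, hv⟩)))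
  calc 2 ^ m = (Finset.univ : Finset (Fin m → Bool)).card := by simp
    _ ≤ _ := Finset.card_le_card hu
    _ ≤ _ := Finset.card_union_le _ _

/-- Each label missing from `l₁` has a vertex in `l₀`, whose partner is deleted in `l₁`; different
labels give different partners. -/
lemma Cross.card_sdiff_le {l₀ l₁ : (Fin m → Bool) → Option α} (h : Cross l₀ l₁) :
    (labels l₀ \ labels l₁).card ≤ (deleted l₁).card := by
  have hs : labels l₀ \ labels l₁ ⊆ Finset.eraseNone ((deleted l₁).image l₀) := by
    intro a ha
    obtain ⟨ha₀, ha₁⟩ := Finset.mem_sdiff.1 ha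
    obtain ⟨v, hv⟩ := mem_labels.1 ha₀
    simp only [Finset.mem_eraseNone, Finset.mem_image, mem_deleted]
    exact ⟨v, h.eq_none hv ha₁, hv⟩
  have hm : (Finset.eraseNone ((deleted l₁).image l₀)).map Function.Embedding.some ⊆
      (deleted l₁).image l₀ := by
    rw [Finset.map_some_eraseNone]
    exact Finset.erase_subset _ _
  calc _ ≤ _ := Finset.card_le_card hs
    _ = _ := (Finset.card_map _).symm
    _ ≤ _ := Finset.card_le_card hm
    _ ≤ _ := Finset.card_image_le

lemma card_labels_union_add_one_le {s t : Finset α} (h : ¬ Disjoint s t) :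
    (s ∪ t).card + 1 ≤ s.card + t.card := by
  have h₁ : 0 < (s ∩ t).card :=
    Finset.card_pos.2 (Finset.not_disjoint_iff_nonempty_inter.1 h)
  have := Finset.card_union_add_card_inter s t
  omega

lemma card_union_le_add_sdiff (s t : Finset α) : (s ∪ t).card = t.card + (s \ t).card := by
  rw [add_comm, Finset.card_sdiff_add_card]

lemma card_labels_le_two_pow (l : (Fin m → Bool) → Option α) : (labels l).card ≤ 2 ^ m := by
  have hm : (labels l).map Function.Embedding.some ⊆ Finset.univ.image l := by
    rw [labels, Finset.map_some_eraseNone]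
    exact Finset.erase_subset _ _
  calc _ = _ := (Finset.card_map _).symm
    _ ≤ _ := Finset.card_le_card hm
    _ ≤ _ := Finset.card_image_le
    _ = 2 ^ m := by simp

lemma sq_add_two_le_two_mul_two_pow (m : ℕ) : m * (m + 1) + 2 ≤ 2 * 2 ^ m := by
  induction m with
  | zero => norm_num
  | succ k ih =>
    have : k + 1 ≤ 2 ^ k := Nat.lt_two_pow_self
    rw [pow_succ]
    nlinarith

/-- The difference of the two sides is `(m - c)(m - c + 1)`, a product of consecutive integers. -/
lemma two_mul_mul_succ_le (m c : ℕ) : 2 * c * (m + 1) ≤ m * (m + 1) + c * (c + 1) := by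
  rcases le_or_gt c m with h | h
  · obtain ⟨d, rfl⟩ := Nat.exists_eq_add_of_le h
    nlinarith
  · obtain ⟨d, rfl⟩ := Nat.exists_eq_add_of_lt h
    nlinarith

/-- In `Q_m`, more than `c` classes force at least `c m - c (c + 1) / 2 + 1` deleted vertices. -/
theorem Compat.deleted_lower_bound {m : ℕ} {l : (Fin m → Bool) → Option α} (h : Compat l) {c : ℕ}
    (hc₁ : 1 ≤ c) (hcm : c ≤ m) (hr : c + 1 ≤ (labels l).card) :
    2 * c * m + 2 ≤ 2 * (deleted l).card + c * (c + 1) := by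
  induction m generalizing c with
  | zero => omega
  | succ m ih =>
    -- A shared label puts all classes in the second half, and the at least `c` of them missing from
    -- the first half each cost a vertex there. For `c = m + 1` the induction hypothesis is only
    -- available at `c = m`, which is enough.
    have key : ∀ l₀ l₁ : (Fin m → Bool) → Option α, Compat l₀ → Compat l₁ → Cross l₀ l₁ →
        c + 1 ≤ (labels l₀ ∪ labels l₁).card → (labels l₀).card ≤ 1 →
        ¬ Disjoint (labels l₀) (labels l₁) →
        2 * c * (m + 1) + 2 ≤ 2 * ((deleted l₀).card + (deleted l₁).card) + c * (c + 1) := by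
      intro l₀ l₁ _ h₁ hx hr h1 hd
      have e := card_labels_union_add_one_le hd
      have e' := card_union_le_add_sdiff (labels l₁) (labels l₀)
      rw [Finset.union_comm] at e'
      have hs := hx.symm.card_sdiff_le
      rcases Nat.lt_or_ge m c with hmc | hmc
      · obtain rfl : c = m + 1 := by omega
        rcases Nat.eq_zero_or_pos m with rfl | hm
        · omega
        · have := ih h₁ hm le_rfl (by omega)
          nlinarith
      · have := ih h₁ hc₁ hmc (by omega)
        nlinarith
    rw [card_deleted_eq]
    rw [labels_eq] at hr
    have h₀ := h.restrict false
    have h₁ := h.restrict true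
    have hx := h.cross
    generalize half false l = l₀ at *
    generalize half true l = l₁ at *
    by_cases hd : Disjoint (labels l₀) (labels l₁)
    · have := hx.two_pow_le hd
      have := sq_add_two_le_two_mul_two_pow m
      have := two_mul_mul_succ_le m c
      omega
    have e := card_labels_union_add_one_le hd
    by_cases c₀ : (labels l₀).card ≤ 1
    · exact key l₀ l₁ h₀ h₁ hx hr c₀ hd
    by_cases c₁ : (labels l₁).card ≤ 1
    · rw [add_comm (deleted l₀).card]
      exact key l₁ l₀ h₁ h₀ hx.symm (by rwa [Finset.union_comm]) c₁ (fun h => hd h.symm)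
    have hm : 1 ≤ m := by
      by_contra hm
      obtain rfl : m = 0 := by omega
      have := card_labels_le_two_pow l₀
      norm_num at this
      omega
    rcases Nat.lt_or_ge 1 c with hc | hc
    -- The shared label gives `c + 2` labels counted over both halves, so `a + b = c` is possible.
    -- The two inductive bounds then exceed the target by `(a - 1)(b - 1)`.
    · obtain ⟨a, b, ha, hb, hab, ha', hb'⟩ : ∃ a b : ℕ, 1 ≤ a ∧ 1 ≤ b ∧ a + b = c ∧
          a + 1 ≤ (labels l₀).card ∧ b + 1 ≤ (labels l₁).card := by
        rcases Nat.lt_or_ge (labels l₀).card c with h | h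
        · exact ⟨(labels l₀).card - 1, c + 1 - (labels l₀).card, by omega, by omega, by omega,
            by omega, by omega⟩
        · exact ⟨c - 1, 1, by omega, by omega, by omega, by omega, by omega⟩
      have i₀ := ih h₀ ha (by omega) ha'
      have i₁ := ih h₁ hb (by omega) hb'
      subst hab
      obtain ⟨a, rfl⟩ := Nat.exists_eq_add_of_le ha
      obtain ⟨b, rfl⟩ := Nat.exists_eq_add_of_le hb
      nlinarith
    · obtain rfl : c = 1 := by omega
      have i₀ := ih h₀ le_rfl hm (by omega)
      have i₁ := ih h₁ le_rfl hm (by omega)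
      omega

end Labellings
-- Parity and the extremal labellings of the cube
section Parity

variable {m : ℕ} {α : Type*} [DecidableEq α]

/-- The number of ones of a binary string, modulo two. -/
def parity (v : Fin m → Bool) : ZMod 2 := ∑ i, if v i then 1 else 0

lemma parity_cons (b : Bool) (v : Fin m → Bool) :
    parity (Fin.cons b v : Fin (m + 1) → Bool) = (if b then 1 else 0) + parity v := by
  simp only [parity, Fin.sum_univ_succ, Fin.cons_zero, Fin.cons_succ]

lemma parity_flipAt (i : Fin m) (v : Fin m → Bool) : parity (flipAt i v) = parity v + 1 := by
  induction m with
  | zero => exact i.elim0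
  | succ m ih =>
    obtain ⟨b, w, rfl⟩ : ∃ b w, v = Fin.cons b w := ⟨v 0, Fin.tail v, by simp⟩
    refine Fin.cases ?_ (fun j => ?_) i
    · rw [flipAt_zero_cons, parity_cons, parity_cons]
      generalize parity w = p
      revert b p
      decide
    · rw [flipAt_succ_cons, parity_cons, parity_cons, ih]
      ring

lemma parity_complementString (v : Fin m → Bool) :
    parity (complementString v) = parity v + m := by
  have h : (m : ZMod 2) = ∑ _i : Fin m, 1 := by simp
  rw [h, parity, parity, ← Finset.sum_add_distrib]
  refine Finset.sum_congr rfl fun i _ => ?_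
  unfold complementString
  cases v i <;> decide

/-- A set of strings of length `3` that contains exactly one end of every edge is a parity class. -/
lemma parity_eq_of_flip {p : (Fin 3 → Bool) → Prop} (h : ∀ v i, p v → ¬ p (flipAt i v))
    (h' : ∀ v i, ¬ p v → p (flipAt i v)) {u v : Fin 3 → Bool} (hu : p u) (hv : p v) :
    parity u = parity v := by
  have key : ∀ w : Fin 3 → Bool, p w ↔ (p (fun _ => false) ↔ parity w = 0) := by
    have step : ∀ w i, p (flipAt i w) ↔ ¬ p w := fun w i =>
      ⟨fun a b => h w i b a, h' w i⟩
    have hz : parity (fun _ : Fin 3 => false) = 0 := by simp [parity]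
    have good : ∀ w i, (p w ↔ (p (fun _ => false) ↔ parity w = 0)) →
        (p (flipAt i w) ↔ (p (fun _ => false) ↔ parity (flipAt i w) = 0)) := by
      intro w i hw
      have e : ∀ x : ZMod 2, x + 1 = 0 ↔ ¬ x = 0 := by decide
      rw [step, parity_flipAt, e]
      tauto
    have h0 : p (fun _ => false) ↔ (p (fun _ => false) ↔ parity (fun _ : Fin 3 => false) = 0) := by
      simp [hz]
    have opt : ∀ (b : Bool) w i, w i = false →
        (p w ↔ (p (fun _ => false) ↔ parity w = 0)) →
        (p (Function.update w i b) ↔ (p (fun _ => false) ↔ parity (Function.update w i b) = 0)) := by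
      intro b w i hi hw
      cases b
      · have e : Function.update w i false = w := by rw [← hi, Function.update_eq_self]
        rwa [e]
      · have := good w i hw
        rwa [flipAt, hi] at this
    intro w
    have := opt (w 2) _ 2 (by simp) (opt (w 1) _ 1 (by simp) (opt (w 0) _ 0 rfl h0))
    have e : w = Function.update (Function.update (Function.update (fun _ => false) 0 (w 0)) 1 (w 1))
        2 (w 2) := by
      funext i
      fin_cases i <;> simp [Function.update]
    rwa [← e] at this
  have e : ∀ x y : ZMod 2, (x = 0 ↔ y = 0) → x = y := by decide
  apply e
  have h₁ := (key u).1 hu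
  have h₂ := (key v).1 hv
  tauto

lemma card_labels_add_card_deleted_le (l : (Fin m → Bool) → Option α) :
    (labels l).card + (deleted l).card ≤ 2 ^ m := by
  have hm : (labels l).map Function.Embedding.some ⊆ (deleted l)ᶜ.image l := by
    intro o ho
    obtain ⟨a, ha, rfl⟩ := Finset.mem_map.1 ho
    obtain ⟨v, hv⟩ := mem_labels.1 ha
    exact Finset.mem_image.2 ⟨v, by simp [mem_deleted, hv], hv⟩
  have h : (labels l).card ≤ (deleted l)ᶜ.card := by
    calc _ = _ := (Finset.card_map _).symm
      _ ≤ _ := Finset.card_le_card hm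
      _ ≤ _ := Finset.card_image_le
  have e := Finset.card_add_card_compl (deleted l)
  simp only [Fintype.card_pi, Fintype.card_bool, Finset.prod_const, Finset.card_univ,
    Fintype.card_fin] at e
  omega

/-- Four classes and four deleted vertices exhaust the eight vertices, so the survivors are isolated
and every edge has exactly one deleted end. -/
lemma Compat.tight_three {l : (Fin 3 → Bool) → Option α} (h : Compat l)
    (hr : 4 ≤ (labels l).card) (hd : (deleted l).card ≤ 4) :
    (labels l).card = 4 ∧ ∃ b, ∀ v ∈ deleted l, parity v = b := by
  have hlow := h.deleted_lower_bound (c := 3) (by norm_num) le_rfl hr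
  have hup := card_labels_add_card_deleted_le l
  have hr4 : (labels l).card = 4 := by omega
  have hd4 : (deleted l).card = 4 := by omega
  have hc4 : (deleted l)ᶜ.card = 4 := by
    rw [Finset.card_compl, hd4]
    simp
  refine ⟨hr4, ?_⟩
  have hinj : ∀ u v, l u ≠ none → l u = l v → u = v := by
    have hm : (labels l).map Function.Embedding.some ⊆ (deleted l)ᶜ.image l := by
      intro o ho
      obtain ⟨a, ha, rfl⟩ := Finset.mem_map.1 ho
      obtain ⟨v, hv⟩ := mem_labels.1 ha
      exact Finset.mem_image.2 ⟨v, by simp [mem_deleted, hv], hv⟩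
    have := Finset.card_le_card hm
    rw [Finset.card_map] at this
    have hi : Set.InjOn l (deleted l)ᶜ := by
      rw [← Finset.coe_compl]
      exact Finset.injOn_of_card_image_eq (le_antisymm Finset.card_image_le (by omega))
    intro u v hu huv
    refine hi ?_ ?_ huv
    · simpa [mem_deleted] using hu
    · simpa [mem_deleted, ← huv] using hu
  have hflip : ∀ (v : Fin 3 → Bool) i, v ≠ flipAt i v := by
    intro v i hv
    have := congrFun hv i
    simp [flipAt] at this
  have h' : ∀ v i, ¬ l v = none → l (flipAt i v) = none := by
    intro v i hv
    rcases h v i with h | h | h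
    · exact absurd h hv
    · exact h
    · exact absurd (hinj _ _ hv h) (hflip v i)
  have h'' : ∀ v i, l v = none → ¬ l (flipAt i v) = none := by
    intro v i hv
    have hs : (deleted l)ᶜ.image (flipAt i) ⊆ deleted l := by
      intro w hw
      obtain ⟨u, hu, rfl⟩ := Finset.mem_image.1 hw
      rw [mem_deleted]
      exact h' u i (by simpa [mem_deleted] using hu)
    have he : (deleted l)ᶜ.image (flipAt i) = deleted l := by
      refine Finset.eq_of_subset_of_card_le hs ?_
      rw [Finset.card_image_of_injective _
        (Function.Involutive.injective (flipAt_flipAt i)), hc4, hd4]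
    have hv' := mem_deleted.2 hv
    rw [← he] at hv'
    obtain ⟨u, hu, rfl⟩ := Finset.mem_image.1 hv'
    rw [flipAt_flipAt]
    simpa [mem_deleted] using hu
  obtain ⟨u, hu⟩ : (deleted l).Nonempty := Finset.card_pos.1 (by omega)
  refine ⟨parity u, fun v hv => ?_⟩
  exact parity_eq_of_flip (p := fun v => l v = none) h'' h' (mem_deleted.1 hv) (mem_deleted.1 hu)

lemma sq_add_two_lt_two_mul_two_pow {m : ℕ} (hm : 3 ≤ m) : m * (m + 1) + 2 < 2 * 2 ^ m := by
  induction m, hm using Nat.le_induction with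
  | base => norm_num
  | succ k hk ih =>
    have : k + 1 ≤ 2 ^ k := Nat.lt_two_pow_self
    rw [pow_succ]
    nlinarith

/-- In `Q_m`, more than `m` classes are possible with `m (m - 1) / 2 + 1` deleted vertices only if
there are exactly `m + 1` classes and all deleted vertices have the same parity. -/
theorem Compat.tight {m : ℕ} (hm : 3 ≤ m) {l : (Fin m → Bool) → Option α} (h : Compat l)
    (hr : m + 1 ≤ (labels l).card) (hd : 2 * (deleted l).card + m ≤ m * m + 2) :
    (labels l).card = m + 1 ∧ ∃ b, ∀ v ∈ deleted l, parity v = b := by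
  induction m, hm using Nat.le_induction with
  | base => exact h.tight_three hr (by omega)
  | succ m hm ih =>
    -- At least `m` labels of `l₀` are missing from `l₁`. The budget then forces exactly `m`
    -- deletions in `l₁` and makes `l₀` extremal.
    have key : ∀ l₀ l₁ : (Fin m → Bool) → Option α, Compat l₀ → Compat l₁ → Cross l₀ l₁ →
        m + 2 ≤ (labels l₀ ∪ labels l₁).card → (labels l₁).card ≤ 2 →
        ¬ Disjoint (labels l₀) (labels l₁) →
        2 * ((deleted l₀).card + (deleted l₁).card) + (m + 1) ≤ (m + 1) * (m + 1) + 2 →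
        (labels l₀ ∪ labels l₁).card = m + 2 ∧
          ∃ b, (∀ v ∈ deleted l₀, parity v = b) ∧ ∀ v ∈ deleted l₁, parity v = b + 1 := by
      intro l₀ l₁ h₀ h₁ hx hr h2 hdis hd
      have e := card_labels_union_add_one_le hdis
      have e' := card_union_le_add_sdiff (labels l₀) (labels l₁)
      have hs := hx.card_sdiff_le
      have b₀ := h₀.deleted_lower_bound (c := m) (by omega) le_rfl (by omega)
      have hr₁ : (labels l₁).card = 2 := by
        by_contra hne
        have : m + 1 ≤ (deleted l₁).card := by omega
        nlinarith
      have b₁ := h₁.deleted_lower_bound (c := 1) le_rfl (by omega) (by omega)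
      have hd₁ : (deleted l₁).card = m := by nlinarith
      obtain ⟨-, b, hb⟩ := ih h₀ (by omega) (by nlinarith)
      refine ⟨by omega, b, hb, ?_⟩
      set E := labels l₀ \ labels l₁ with hE
      have hEm : E.card = m := by omega
      set X := Finset.univ.filter fun v => ∃ a ∈ E, l₀ v = some a with hX
      have hXd : X ⊆ deleted l₁ := by
        intro v hv
        obtain ⟨a, ha, hav⟩ := (Finset.mem_filter.1 hv).2
        exact mem_deleted.2 (hx.eq_none hav (Finset.mem_sdiff.1 ha).2)
      have hEX : E.map Function.Embedding.some ⊆ X.image l₀ := by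
        intro o ho
        obtain ⟨a, ha, rfl⟩ := Finset.mem_map.1 ho
        obtain ⟨v, hv⟩ := mem_labels.1 (Finset.mem_sdiff.1 ha).1
        exact Finset.mem_image.2 ⟨v, Finset.mem_filter.2 ⟨Finset.mem_univ _, a, ha, hv⟩, hv⟩
      have c₁ := Finset.card_le_card hEX
      rw [Finset.card_map] at c₁
      have c₂ := Finset.card_le_card hXd
      have c₃ : (X.image l₀).card ≤ X.card := Finset.card_image_le
      -- Equality in the count makes the classes in `E` singletons whose partners are all of
      -- `deleted l₁`. The neighbours of a singleton in `l₀` are deleted, which fixes its parity as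
      -- `b + 1`.
      have hXe : X = deleted l₁ := Finset.eq_of_subset_of_card_le hXd (by omega)
      have hinj : Set.InjOn l₀ X := Finset.injOn_of_card_image_eq (by omega)
      intro v hv
      rw [← hXe] at hv
      obtain ⟨a, ha, hav⟩ := (Finset.mem_filter.1 hv).2
      let i : Fin m := ⟨0, by omega⟩
      have e₂ : ∀ x y : ZMod 2, x + 1 = y → x = y + 1 := by decide
      rcases h₀ v i with h | h | h
      · simp [h] at hav
      · exact e₂ _ _ (by rw [← parity_flipAt i]; exact hb _ (mem_deleted.2 h))
      · have hv' : flipAt i v ∈ X := Finset.mem_filter.2 ⟨Finset.mem_univ _, a, ha, h ▸ hav⟩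
        have := congrFun (hinj hv hv' h) i
        simp [flipAt] at this
    rw [card_deleted_eq] at hd
    rw [labels_eq] at hr ⊢
    have h₀ := h.restrict false
    have h₁ := h.restrict true
    have hx := h.cross
    have hcons : ∀ v : Fin (m + 1) → Bool, v ∈ deleted l →
        (v 0 = false ∧ Fin.tail v ∈ deleted (half false l)) ∨
        (v 0 = true ∧ Fin.tail v ∈ deleted (half true l)) := by
      intro v hv
      rw [mem_deleted] at hv
      rcases hb : v 0 with _ | _
      · exact Or.inl ⟨rfl, mem_deleted.2 (by simpa [half, ← hb] using hv)⟩
      · exact Or.inr ⟨rfl, mem_deleted.2 (by simpa [half, ← hb] using hv)⟩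
    have hpar : ∀ v : Fin (m + 1) → Bool,
        parity v = (if v 0 then 1 else 0) + parity (Fin.tail v) := by
      intro v
      rw [← parity_cons, Fin.cons_self_tail]
    generalize half false l = l₀ at *
    generalize half true l = l₁ at *
    have two : ∀ x : ZMod 2, 1 + (x + 1) = x := by decide
    by_cases hdis : Disjoint (labels l₀) (labels l₁)
    · have := hx.two_pow_le hdis
      have := sq_add_two_lt_two_mul_two_pow hm
      nlinarith
    have e := card_labels_union_add_one_le hdis
    by_cases c₁ : (labels l₁).card ≤ 2
    · obtain ⟨hc, b, hb₀, hb₁⟩ := key l₀ l₁ h₀ h₁ hx hr c₁ hdis hd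
      refine ⟨hc, b, fun v hv => ?_⟩
      rcases hcons v hv with ⟨h0, hv⟩ | ⟨h0, hv⟩
      · rw [hpar, h0, hb₀ _ hv]; simp
      · rw [hpar, h0, hb₁ _ hv]; simp [two]
    by_cases c₀ : (labels l₀).card ≤ 2
    · obtain ⟨hc, b, hb₀, hb₁⟩ := key l₁ l₀ h₁ h₀ hx.symm (by rwa [Finset.union_comm]) c₀
        (fun h => hdis h.symm) (by rwa [add_comm (deleted l₁).card])
      refine ⟨by rwa [Finset.union_comm], b + 1, fun v hv => ?_⟩
      rcases hcons v hv with ⟨h0, hv⟩ | ⟨h0, hv⟩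
      · rw [hpar, h0, hb₁ _ hv]; simp
      · rw [hpar, h0, hb₀ _ hv]; simp [add_comm]
    -- Here `a, b ≥ 2`, so the surplus `(a - 1)(b - 1)` is positive and extremality fails.
    obtain ⟨a, b, ha, hb, hab, ha', hb'⟩ : ∃ a b : ℕ, 2 ≤ a ∧ 2 ≤ b ∧ a + b = m + 1 ∧
        a + 1 ≤ (labels l₀).card ∧ b + 1 ≤ (labels l₁).card := by
      rcases Nat.lt_or_ge (labels l₀).card m with h | h
      · exact ⟨(labels l₀).card - 1, m + 2 - (labels l₀).card, by omega, by omega, by omega,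
          by omega, by omega⟩
      · exact ⟨m - 1, 2, by omega, by omega, by omega, by omega, by omega⟩
    have i₀ := h₀.deleted_lower_bound (c := a) (by omega) (by omega) ha'
    have i₁ := h₁.deleted_lower_bound (c := b) (by omega) (by omega) hb'
    exfalso
    obtain rfl : m = a + b - 1 := by omega
    obtain ⟨a, rfl⟩ := Nat.exists_eq_add_of_le ha
    obtain ⟨b, rfl⟩ := Nat.exists_eq_add_of_le hb
    have hmm : 2 + a + (2 + b) - 1 = a + b + 3 := by omega
    rw [hmm] at *
    nlinarith

end Parity
-- Lower bound for a fixed splitting of the folded cube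
section Folded

variable {m : ℕ} {α : Type*} [DecidableEq α]

/-- The lower bound in `FQ_{m+1}`, stated for the labellings of the two halves. The hypotheses
`hs₀` and `hs₁` deal with splittings in which one half meets few classes. -/
theorem Cross.folded_lower_bound (hm : 5 ≤ m) {l₀ l₁ : (Fin m → Bool) → Option α}
    (h₀ : Compat l₀) (h₁ : Compat l₁) (hx : Cross l₀ l₁)
    (hx' : Cross l₀ (l₁ ∘ complementString))
    (hr : m + 4 ≤ (labels l₀ ∪ labels l₁).card)
    (hs₀ : (labels l₀).card ≤ 3 → 2 * m ≤ (deleted l₀).card)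
    (hs₁ : (labels l₁).card ≤ 3 → 2 * m ≤ (deleted l₁).card) :
    (m + 2) * (m + 1) < 2 * ((deleted l₀).card + (deleted l₁).card) := by
  -- Beyond the `2m` deletions in `l₁`, the budget leaves `m(m-1)/2 + 1` for `l₀`, which meets at
  -- least `m + 2` classes: one more than `Compat.tight` permits.
  have few : ∀ l₀ l₁ : (Fin m → Bool) → Option α, Compat l₀ →
      m + 4 ≤ (labels l₀ ∪ labels l₁).card → (labels l₁).card ≤ 3 →
      2 * m ≤ (deleted l₁).card → ¬ Disjoint (labels l₀) (labels l₁) →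
      (m + 2) * (m + 1) < 2 * ((deleted l₀).card + (deleted l₁).card) := by
    intro l₀ l₁ h₀ hr h3 hd hdis
    have e := card_labels_union_add_one_le hdis
    by_contra hlt
    have := (h₀.tight (by omega) (by omega) (by nlinarith)).1
    omega
  -- The tie at `m = 5` is `11 + 10 = 21`. A vertex of `l₁` whose label is missing from `l₀` has two
  -- deleted partners there, which are complementary and so of opposite parity because `m` is odd.
  have five : ∀ l₀ l₁ : (Fin m → Bool) → Option α, Compat l₀ → Cross l₀ l₁ →
      Cross l₀ (l₁ ∘ complementString) → m + 4 ≤ (labels l₀ ∪ labels l₁).card → m = 5 →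
      6 ≤ (labels l₀).card → 10 ≤ (deleted l₁).card →
      (m + 2) * (m + 1) < 2 * ((deleted l₀).card + (deleted l₁).card) := by
    intro l₀ l₁ h₀ hx hx' hr hm h6 hd
    subst hm
    by_contra hlt
    obtain ⟨hc, b, hb⟩ := h₀.tight (by omega) (by omega) (by omega)
    have e := card_union_le_add_sdiff (labels l₁) (labels l₀)
    rw [Finset.union_comm] at e
    obtain ⟨a, ha⟩ : (labels l₁ \ labels l₀).Nonempty := Finset.card_pos.1 (by omega)
    obtain ⟨ha₁, ha₀⟩ := Finset.mem_sdiff.1 ha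
    obtain ⟨v, hv⟩ := mem_labels.1 ha₁
    have d₁ := hx.symm.eq_none hv ha₀
    have d₂ := hx'.symm.eq_none (v := complementString v) (a := a)
      (by simpa [complementString_involutive v] using hv) ha₀
    have p₁ := hb _ (mem_deleted.2 d₁)
    have p₂ := hb _ (mem_deleted.2 d₂)
    rw [parity_complementString, p₁] at p₂
    revert p₂
    generalize b = x
    revert x
    decide
  have hx'' : Cross l₁ (l₀ ∘ complementString) := by
    intro v
    have := hx'.symm (complementString v)
    simpa [complementString_involutive v] using this
  by_cases hdis : Disjoint (labels l₀) (labels l₁)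
  · have := hx.two_pow_le hdis
    have : (m + 2) * (m + 1) < 2 * 2 ^ m := by
      clear * - hm
      induction m, hm using Nat.le_induction with
      | base => norm_num
      | succ k hk ih =>
        rw [pow_succ]
        nlinarith
    omega
  by_cases c₁ : (labels l₁).card ≤ 3
  · exact few l₀ l₁ h₀ hr c₁ (hs₁ c₁) hdis
  by_cases c₀ : (labels l₀).card ≤ 3
  · rw [add_comm (deleted l₀).card]
    exact few l₁ l₀ h₁ (by rwa [Finset.union_comm]) c₀ (hs₀ c₀) fun h => hdis h.symm
  have e := card_labels_union_add_one_le hdis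
  have hr' := hr
  rw [Finset.union_comm] at hr'
  obtain ⟨a, b, ha, hb, hab, ha', hb'⟩ : ∃ a b : ℕ, 3 ≤ a ∧ 3 ≤ b ∧ a + b = m + 3 ∧
      a + 1 ≤ (labels l₀).card ∧ b + 1 ≤ (labels l₁).card := by
    rcases Nat.lt_or_ge (labels l₀).card (m + 1) with h | h
    · exact ⟨(labels l₀).card - 1, m + 4 - (labels l₀).card, by omega, by omega, by omega,
        by omega, by omega⟩
    · exact ⟨m, 3, by omega, by omega, by omega, by omega, by omega⟩
  have i₀ := h₀.deleted_lower_bound (c := a) (by omega) (by omega) ha'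
  have i₁ := h₁.deleted_lower_bound (c := b) (by omega) (by omega) hb'
  -- The sum of the bounds exceeds `(m+2)(m+1)/2` by `(m - 5) + (a - 3)(b - 3)`, which vanishes only
  -- for `m = 5` and `{a, b} = {3, 5}`.
  rcases hm.eq_or_lt with rfl | hm
  · obtain ⟨rfl, rfl⟩ | ⟨rfl, rfl⟩ | ⟨rfl, rfl⟩ : (a = 5 ∧ b = 3) ∨ (a = 4 ∧ b = 4) ∨
        (a = 3 ∧ b = 5) := by
      clear * - ha hb hab ha' hb' i₀ i₁
      omega
    · exact five l₀ l₁ h₀ hx hx' hr rfl ha' (by omega)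
    · omega
    · rw [add_comm (deleted l₀).card]
      exact five l₁ l₀ h₁ hx.symm hx'' hr' rfl hb' (by omega)
  · generalize (deleted l₀).card = d₀ at i₀ ⊢
    generalize (deleted l₁).card = d₁ at i₁ ⊢
    clear * - hab ha hb hm i₀ i₁
    obtain ⟨a, rfl⟩ := Nat.exists_eq_add_of_le ha
    obtain ⟨b, rfl⟩ := Nat.exists_eq_add_of_le hb
    obtain rfl : m = a + b + 3 := by omega
    nlinarith [Nat.zero_le (a * b)]

/-- A partial labelling of the folded hypercube in which adjacent vertices that are not deleted
carry the same label. -/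
def FoldedCompat (l : (Fin m → Bool) → Option α) : Prop :=
  Compat l ∧ Cross l (l ∘ complementString)

/-- The string `v` with the bits in `D` flipped. -/
def flipOn (D : Finset (Fin m)) (v : Fin m → Bool) : Fin m → Bool := fun i => xor (v i) (i ∈ D)

/-- Flipping all bits but the first composes the two matchings between the halves, so it relates
exactly the vertices with a common neighbour across. -/
lemma flipOn_compl_zero_cons (b : Bool) (v : Fin m → Bool) :
    flipOn ({0}ᶜ : Finset (Fin (m + 1))) (Fin.cons b v) = Fin.cons b (complementString v) := by
  funext i
  refine Fin.cases ?_ (fun j => ?_) i <;> simp [flipOn, complementString]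

lemma even_card_of_involutive {β : Type*} [DecidableEq β] {f : β → β} (hf : Function.Involutive f)
    (hne : ∀ x, f x ≠ x) {S : Finset β} (hS : ∀ x ∈ S, f x ∈ S) : Even S.card := by
  have : ∑ _x ∈ S, (1 : ZMod 2) = 0 :=
    Finset.sum_involution (fun x _ => f x) (fun _ _ => by decide) (fun x _ _ => hne x)
      (fun x hx => hS x hx) (fun x _ => hf x)
  rw [Finset.sum_const, nsmul_one] at this
  exact (ZMod.natCast_eq_zero_iff_even).1 this

/-- If few classes meet one half, then the representatives of the other classes in the other half
have many neighbours. -/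
lemma two_mul_le_card_deleted {l₀ l₁ : (Fin m → Bool) → Option α} (hm : 1 ≤ m)
    (hx : Cross l₀ l₁) (hx' : Cross l₀ (l₁ ∘ complementString)) {S : Finset (Fin m → Bool)}
    (hS : ∀ v ∈ S, ∃ a, l₀ v = some a ∧ a ∉ labels l₁) (hcard : m + 1 ≤ S.card)
    (hanti : (S.filter fun v => complementString v ∈ S).card ≤ 3) :
    2 * m ≤ (deleted l₁).card := by
  have hinv := complementString_involutive (m := m)
  have hne : ∀ v : Fin m → Bool, complementString v ≠ v := by
    intro v hv
    have := congrFun hv ⟨0, by omega⟩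
    simp [complementString] at this
  -- Complementary pairs make this number even, so at most three means at most two, leaving `2(m +
  -- 1) - 2 = 2m` distinct neighbours.
  have hev : Even (S.filter fun v => complementString v ∈ S).card :=
    even_card_of_involutive hinv hne fun v hv => by
      obtain ⟨a, b⟩ := Finset.mem_filter.1 hv
      exact Finset.mem_filter.2 ⟨b, by rwa [hinv v]⟩
  have hsub : S ∪ S.image complementString ⊆ deleted l₁ := by
    intro v hv
    rw [mem_deleted]
    rcases Finset.mem_union.1 hv with hv | hv
    · obtain ⟨a, ha, ha'⟩ := hS v hv
      exact hx.eq_none ha ha'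
    · obtain ⟨w, hw, rfl⟩ := Finset.mem_image.1 hv
      obtain ⟨a, ha, ha'⟩ := hS w hw
      rcases hx' w with h | h | h
      · simp [h] at ha
      · exact h
      · exact absurd (mem_labels.2 ⟨complementString w, h.symm.trans ha⟩) ha'
  have hint : S ∩ S.image complementString = S.filter fun v => complementString v ∈ S := by
    ext v
    simp only [Finset.mem_inter, Finset.mem_image, Finset.mem_filter, and_congr_right_iff]
    intro _
    constructor
    · rintro ⟨w, hw, rfl⟩
      rwa [hinv w]
    · intro h
      exact ⟨_, h, hinv v⟩
  have c₁ := Finset.card_union_add_card_inter S (S.image complementString)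
  rw [hint, Finset.card_image_of_injective _ hinv.injective] at c₁
  have c₂ := Finset.card_le_card hsub
  obtain ⟨k, hk⟩ := hev
  omega

lemma FoldedCompat.lower_bound_of_split (hm : 5 ≤ m) {l : (Fin (m + 1) → Bool) → Option α}
    (h : FoldedCompat l) {R : Finset (Fin (m + 1) → Bool)} (hR : m + 4 ≤ R.card)
    (hsome : ∀ v ∈ R, l v ≠ none) (hinj : Set.InjOn l R)
    (hsplit : (R.filter fun v => flipOn {0}ᶜ v ∈ R).card ≤ 3) :
    (m + 2) * (m + 1) < 2 * (deleted l).card := by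
  have hx (b : Bool) : Cross (half b l) (half (!b) l) := by
    cases b
    · exact h.1.cross
    · exact h.1.cross.symm
  have hx' (b : Bool) : Cross (half b l) (half (!b) l ∘ complementString) := by
    intro v
    have := h.2 (Fin.cons b v)
    rwa [Function.comp_apply, complementString_cons] at this
  have hRl : ∀ R' ⊆ R, ∀ L : Finset α, (∀ v ∈ R', ∃ a ∈ L, l v = some a) → R'.card ≤ L.card := by
    intro R' hR' L hL
    rw [← Finset.card_map Function.Embedding.some (s := L),
      ← Finset.card_image_of_injOn (hinj.mono (Finset.coe_subset.2 hR'))]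
    refine Finset.card_le_card fun o ho => ?_
    obtain ⟨v, hv, rfl⟩ := Finset.mem_image.1 ho
    obtain ⟨a, ha, hav⟩ := hL v hv
    exact Finset.mem_map.2 ⟨a, ha, hav.symm⟩
  have hs (b : Bool) (hb : (labels (half (!b) l)).card ≤ 3) :
      2 * m ≤ (deleted (half (!b) l)).card := by
    -- Representatives outside `R₁` have labels absent from the half `!b`, hence lie in the half
    -- `b`; at least `m + 4 - 3` of them remain.
    set R₁ := R.filter fun v => ∃ a ∈ labels (half (!b) l), l v = some a with hR₁
    have c₁ : R₁.card ≤ 3 :=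
      (hRl R₁ (Finset.filter_subset _ _) _ fun v hv => (Finset.mem_filter.1 hv).2).trans hb
    set S : Finset (Fin m → Bool) :=
      Finset.univ.filter fun v => (Fin.cons b v : Fin (m + 1) → Bool) ∈ R \ R₁ with hSdef
    have hSR : ∀ v ∈ S, (Fin.cons b v : Fin (m + 1) → Bool) ∈ R \ R₁ :=
      fun v hv => (Finset.mem_filter.1 hv).2
    have hci : Function.Injective
        (fun v : Fin m → Bool => (Fin.cons b v : Fin (m + 1) → Bool)) :=
      Fin.cons_right_injective (α := fun _ => Bool) b
    have hSc : R \ R₁ ⊆ S.image fun v => (Fin.cons b v : Fin (m + 1) → Bool) := by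
      intro v hv
      obtain ⟨hvR, hv₁⟩ := Finset.mem_sdiff.1 hv
      have hv0 : v 0 = b := by
        by_contra hne
        have hb' : v 0 = !b := by cases hv : v 0 <;> cases b <;> simp_all
        obtain ⟨a, ha⟩ := Option.ne_none_iff_exists'.1 (hsome v hvR)
        refine hv₁ (Finset.mem_filter.2 ⟨hvR, a, mem_labels.2 ⟨Fin.tail v, ?_⟩, ha⟩)
        rwa [half, ← hb', Fin.cons_self_tail]
      have hcv : (Fin.cons b (Fin.tail v) : Fin (m + 1) → Bool) = v := by
        rw [← hv0, Fin.cons_self_tail]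
      exact Finset.mem_image.2 ⟨Fin.tail v,
        Finset.mem_filter.2 ⟨Finset.mem_univ _, by rwa [hcv]⟩, hcv⟩
    have c₂ := (Finset.card_le_card hSc).trans Finset.card_image_le
    have c₃ := Finset.le_card_sdiff R₁ R
    refine two_mul_le_card_deleted (by omega) (hx b) (hx' b) (S := S) ?_ (by omega) ?_
    · intro v hv
      obtain ⟨hvR, hv₁⟩ := Finset.mem_sdiff.1 (hSR v hv)
      obtain ⟨a, ha⟩ := Option.ne_none_iff_exists'.1 (hsome _ hvR)
      exact ⟨a, ha, fun hl => hv₁ (Finset.mem_filter.2 ⟨hvR, a, hl, ha⟩)⟩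
    · refine le_trans ?_ hsplit
      rw [← Finset.card_image_of_injective _ hci]
      refine Finset.card_le_card fun w hw => ?_
      obtain ⟨v, hv, rfl⟩ := Finset.mem_image.1 hw
      obtain ⟨hv, hv'⟩ := Finset.mem_filter.1 hv
      refine Finset.mem_filter.2 ⟨(Finset.mem_sdiff.1 (hSR v hv)).1, ?_⟩
      rw [flipOn_compl_zero_cons]
      exact (Finset.mem_sdiff.1 (hSR _ hv')).1
  rw [card_deleted_eq]
  refine Cross.folded_lower_bound hm (h.1.restrict false) (h.1.restrict true) (hx false) (hx' false)
    ?_ (hs true) (hs false)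
  rw [← labels_eq]
  refine hR.trans (hRl R subset_rfl _ fun v hv => ?_)
  obtain ⟨a, ha⟩ := Option.ne_none_iff_exists'.1 (hsome v hv)
  exact ⟨a, mem_labels.2 ⟨v, ha⟩, ha⟩

end Folded
-- Automorphisms of the folded cube and choice of a splitting
section Automorphisms

variable {n : ℕ} {α : Type*} [DecidableEq α]

lemma flipAt_eq_flipOn (i : Fin n) (v : Fin n → Bool) : flipAt i v = flipOn {i} v := by
  funext k
  by_cases hk : k = i
  · subst hk; simp [flipAt, flipOn]
  · simp [flipAt, flipOn, hk]

lemma complementString_eq_flipOn (v : Fin n → Bool) :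
    complementString v = flipOn Finset.univ v := by
  funext k; simp [complementString, flipOn]

/-- The automorphism of the folded hypercube that exchanges flipping the `j`-th bit and taking
complements. -/
def exchange (j : Fin n) (v : Fin n → Bool) : Fin n → Bool :=
  fun k => if k = j then v k else xor (v k) (v j)

lemma exchange_involutive (j : Fin n) : Function.Involutive (exchange j) := by
  intro v; funext k
  by_cases hk : k = j <;> simp [exchange, hk]

lemma exchange_flipOn_of_notMem {j : Fin n} {D : Finset (Fin n)} (hj : j ∉ D) (v : Fin n → Bool) :
    exchange j (flipOn D v) = flipOn D (exchange j v) := by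
  funext k
  by_cases hk : k = j
  · simp [exchange, flipOn, hk]
  · simp only [exchange, flipOn, hk, if_false, hj, decide_false, Bool.xor_false]
    cases v k <;> cases v j <;> cases decide (k ∈ D) <;> rfl

/-- `exchange j` is linear over the field of two elements, fixes the other unit vectors and sends
the `j`-th one to the all-ones vector. -/
lemma exchange_flipOn_of_mem {j : Fin n} {D : Finset (Fin n)} (hj : j ∈ D) (v : Fin n → Bool) :
    exchange j (flipOn D v) = flipOn (insert j Dᶜ) (exchange j v) := by
  funext k
  by_cases hk : k = j
  · simp [exchange, flipOn, hk, hj]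
  · by_cases hD : k ∈ D <;> simp [exchange, flipOn, hk, hj, hD]

lemma FoldedCompat.comp_exchange {l : (Fin n → Bool) → Option α} (h : FoldedCompat l) (j : Fin n) :
    FoldedCompat (l ∘ exchange j) := by
  refine ⟨fun v i => ?_, fun v => ?_⟩
  · simp only [Function.comp_apply, flipAt_eq_flipOn]
    by_cases hij : i = j
    · subst hij
      rw [exchange_flipOn_of_mem (by simp)]
      have := h.2 (exchange i v)
      simpa [complementString_eq_flipOn] using this
    · rw [exchange_flipOn_of_notMem (by simpa using Ne.symm hij), ← flipAt_eq_flipOn]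
      exact h.1 _ _
  · simp only [Function.comp_apply, complementString_eq_flipOn]
    rw [exchange_flipOn_of_mem (by simp)]
    have := h.1 (exchange j v) j
    simpa [flipAt_eq_flipOn] using this

lemma flipOn_comp_perm (σ : Equiv.Perm (Fin n)) (D : Finset (Fin n)) (v : Fin n → Bool) :
    flipOn D v ∘ σ = flipOn (D.map σ.symm.toEmbedding) (v ∘ σ) := by
  funext k
  simp [flipOn, Finset.mem_map_equiv]

lemma FoldedCompat.comp_perm {l : (Fin n → Bool) → Option α} (h : FoldedCompat l)
    (σ : Equiv.Perm (Fin n)) : FoldedCompat fun v => l (v ∘ σ) := by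
  refine ⟨fun v i => ?_, fun v => ?_⟩
  · beta_reduce
    rw [flipAt_eq_flipOn, flipOn_comp_perm, Finset.map_singleton, ← flipAt_eq_flipOn]
    exact h.1 _ _
  · exact h.2 (v ∘ σ)

/-- A family of representatives together with a splitting that separates few pairs of them. -/
def GoodSplit (l : (Fin n → Bool) → Option α) (R : Finset (Fin n → Bool)) (k : ℕ)
    (D : Finset (Fin n)) : Prop :=
  k ≤ R.card ∧ (∀ v ∈ R, l v ≠ none) ∧ Set.InjOn l R ∧
    (R.filter fun v => flipOn D v ∈ R).card ≤ 3

lemma GoodSplit.comp {l : (Fin n → Bool) → Option α} {R : Finset (Fin n → Bool)} {k : ℕ}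
    {D D' : Finset (Fin n)} (h : GoodSplit l R k D) (e : (Fin n → Bool) ≃ (Fin n → Bool))
    (he : ∀ v, e (flipOn D' v) = flipOn D (e v)) :
    GoodSplit (l ∘ e) (R.map e.symm.toEmbedding) k D' := by
  obtain ⟨h₁, h₂, h₃, h₄⟩ := h
  refine ⟨by simpa using h₁, fun v hv => h₂ _ (by simpa [Finset.mem_map_equiv] using hv), ?_, ?_⟩
  · intro u hu v hv huv
    refine e.injective (h₃ ?_ ?_ huv)
    · simpa [Finset.mem_map_equiv] using hu
    · simpa [Finset.mem_map_equiv] using hv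
  · refine le_trans (le_of_eq ?_) h₄
    rw [← Finset.card_map e.toEmbedding]
    congr 1
    ext v
    simp only [Finset.mem_map_equiv, Finset.mem_filter, Equiv.symm_symm, Equiv.apply_symm_apply, he]

lemma card_deleted_comp (l : (Fin n → Bool) → Option α) (e : (Fin n → Bool) ≃ (Fin n → Bool)) :
    (deleted (l ∘ e)).card = (deleted l).card := by
  rw [← Finset.card_map e.toEmbedding]
  congr 1
  ext v
  simp [Finset.mem_map_equiv, mem_deleted]

/-- The splittings of the folded hypercube into two hypercubes, as sets of flipped bits. -/
def splits (n : ℕ) : Finset (Finset (Fin n)) :=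
  Finset.powersetCard 2 Finset.univ ∪ Finset.univ.image fun i => {i}ᶜ

/-- The automorphism group permutes the matchings: `exchange j` turns a pair of bit flips into a bit
flip and the complement, and a coordinate swap makes that bit the first. -/
lemma FoldedCompat.lower_bound_of_goodSplit {m : ℕ} (hm : 5 ≤ m)
    {l : (Fin (m + 1) → Bool) → Option α} (h : FoldedCompat l) {R : Finset (Fin (m + 1) → Bool)}
    {D : Finset (Fin (m + 1))} (hD : D ∈ splits (m + 1)) (hR : GoodSplit l R (m + 4) D) :
    (m + 2) * (m + 1) < 2 * (deleted l).card := by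
  have single : ∀ (l : (Fin (m + 1) → Bool) → Option α) (R : Finset (Fin (m + 1) → Bool))
      (i : Fin (m + 1)), FoldedCompat l → GoodSplit l R (m + 4) {i}ᶜ →
      (m + 2) * (m + 1) < 2 * (deleted l).card := by
    intro l R i h hR
    let σ : Equiv.Perm (Fin (m + 1)) := Equiv.swap 0 i
    let e : (Fin (m + 1) → Bool) ≃ (Fin (m + 1) → Bool) := Equiv.arrowCongr σ (Equiv.refl Bool)
    have he : ∀ v, e v = v ∘ σ := fun v => by
      funext k
      simp [e, σ]
    have hl : FoldedCompat (l ∘ e) := by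
      have := h.comp_perm σ
      have e' : (l ∘ e) = fun v => l (v ∘ σ) := by funext v; simp [he]
      rwa [e']
    obtain ⟨h₁, h₂, h₃, h₄⟩ := hR.comp (D' := {0}ᶜ) e (fun v => by
      rw [he, he, flipOn_comp_perm]
      congr 1
      ext k
      rw [Finset.mem_map_equiv]
      simp [σ, Equiv.swap_apply_eq_iff])
    rw [← card_deleted_comp l e]
    exact hl.lower_bound_of_split hm h₁ h₂ h₃ h₄
  rcases Finset.mem_union.1 hD with hD | hD
  · obtain ⟨i, j, hij, rfl⟩ := Finset.card_eq_two.1 (Finset.mem_powersetCard.1 hD).2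
    let e : (Fin (m + 1) → Bool) ≃ (Fin (m + 1) → Bool) := (exchange_involutive j).toPerm
    rw [← card_deleted_comp l e]
    refine single (l ∘ e) _ i (h.comp_exchange j) (hR.comp e fun v => ?_)
    change exchange j (flipOn {i}ᶜ v) = flipOn {i, j} (exchange j v)
    rw [exchange_flipOn_of_mem (by simpa using hij.symm), compl_compl, Finset.pair_comm]
  · obtain ⟨i, -, rfl⟩ := Finset.mem_image.1 hD
    exact single l R i h hR

lemma card_splits {n : ℕ} (hn : 4 ≤ n) : 2 * (splits n).card = n * (n + 1) := by
  rw [splits, Finset.card_union_of_disjoint, Finset.card_powersetCard, Finset.card_image_of_injective,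
    Finset.card_univ, Fintype.card_fin, mul_add, Nat.choose_two_right,
    Nat.mul_div_cancel' (Nat.even_mul_pred_self n).two_dvd]
  · obtain ⟨k, rfl⟩ := Nat.exists_eq_add_of_le hn
    have : 4 + k - 1 = k + 3 := by omega
    rw [this]
    ring
  · intro i j hij
    simpa using hij
  · rw [Finset.disjoint_left]
    intro D h₁ h₂
    have c := (Finset.mem_powersetCard.1 h₁).2
    obtain ⟨i, -, rfl⟩ := Finset.mem_image.1 h₂
    rw [Finset.card_compl, Finset.card_singleton, Fintype.card_fin] at c
    omega

/-- By averaging, some splitting separates few pairs of a set of `n + 3` vertices. -/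
lemma exists_split {n : ℕ} (hn : 6 ≤ n) {R : Finset (Fin n → Bool)} (hR : R.card = n + 3) :
    ∃ D ∈ splits n, (R.filter fun v => flipOn D v ∈ R).card ≤ 3 := by
  by_contra! hcon
  have c₁ := card_splits (n := n) (by omega)
  have h₁ : (splits n).card * 4 ≤ ∑ D ∈ splits n, (R.filter fun v => flipOn D v ∈ R).card := by
    rw [← smul_eq_mul]
    exact Finset.card_nsmul_le_sum _ _ _ fun D hD => hcon D hD
  -- The endpoints `v` and `flipOn D v` determine `D`, so each ordered pair of distinct
  -- representatives is counted at most once.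
  have h₂ : ∑ D ∈ splits n, (R.filter fun v => flipOn D v ∈ R).card ≤ R.offDiag.card := by
    rw [← Finset.card_sigma]
    refine Finset.card_le_card_of_injOn (fun p => (p.2, flipOn p.1 p.2)) ?_ ?_
    · rintro ⟨D, v⟩ hp
      obtain ⟨hD, hv⟩ := Finset.mem_sigma.1 hp
      obtain ⟨hv, hv'⟩ := Finset.mem_filter.1 hv
      refine Finset.mem_coe.2 (Finset.mem_offDiag.2 ⟨hv, hv', fun heq => ?_⟩)
      have hemp : D = ∅ := by
        ext k
        have := congrFun heq k
        by_cases hk : k ∈ D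
        · simp [flipOn, hk] at this
        · simp [hk]
      simp only [hemp, splits, Finset.mem_union, Finset.mem_powersetCard, Finset.mem_image] at hD
      rcases hD with ⟨-, hD⟩ | ⟨i, -, hD⟩
      · simp at hD
      · have := congrArg Finset.card hD
        rw [Finset.card_compl, Finset.card_singleton, Fintype.card_fin, Finset.card_empty] at this
        omega
    · rintro ⟨D, v⟩ - ⟨D', v'⟩ - heq
      obtain ⟨rfl, h⟩ := Prod.mk.inj heq
      have : D = D' := by
        ext k
        have := congrFun h k
        simpa [flipOn] using this
      rw [this]
  rw [Finset.offDiag_card, hR] at h₂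
  have h₃ : (n + 3) * (n + 3) - (n + 3) = (n + 3) * (n + 2) := by
    rw [← Nat.mul_sub_one]; rfl
  rw [h₃] at h₂
  -- Four per splitting would give `2n(n+1) ≤ (n+3)(n+2)`, which is false for `n ≥ 6`.
  nlinarith

/-- The lower bound on the number of deleted vertices for labellings of the folded hypercube. -/
theorem FoldedCompat.lower_bound {n : ℕ} (hn : 6 ≤ n) {l : (Fin n → Bool) → Option α}
    (h : FoldedCompat l) (hr : n + 3 ≤ (labels l).card) :
    (n + 1) * n < 2 * (deleted l).card := by
  obtain ⟨L, hL, hLc⟩ := Finset.exists_subset_card_eq hr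
  have hrep : ∀ a : L, ∃ v, l v = some a.1 := fun a => mem_labels.1 (hL a.2)
  choose rep hrep using hrep
  have hri : Function.Injective rep := by
    intro a b hab
    have := hrep a
    rw [hab, hrep b] at this
    exact Subtype.ext (Option.some.inj this).symm
  have hRc : (Finset.univ.image rep).card = n + 3 := by
    rw [Finset.card_image_of_injective _ hri, Finset.card_univ, Fintype.card_coe, hLc]
  obtain ⟨D, hD, hDc⟩ := exists_split hn hRc
  obtain ⟨m, rfl⟩ : ∃ m, n = m + 1 := ⟨n - 1, by omega⟩
  refine h.lower_bound_of_goodSplit (by omega) hD ⟨hRc.ge, ?_, ?_, hDc⟩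
  · intro v hv
    obtain ⟨a, -, rfl⟩ := Finset.mem_image.1 hv
    simp [hrep]
  · intro u hu v hv huv
    obtain ⟨a, -, rfl⟩ := Finset.mem_image.1 hu
    obtain ⟨b, -, rfl⟩ := Finset.mem_image.1 hv
    rw [hrep, hrep] at huv
    rw [Subtype.ext (Option.some.inj huv)]

end Automorphisms
-- From component cuts to labellings, and existence of a cut
section ComponentCuts

variable {n : ℕ}

lemma hypercube_adj_flipAt (v : Fin n → Bool) (i : Fin n) : (hypercube n).Adj v (flipAt i v) := by
  change hammingDist v (flipAt i v) = 1
  rw [hammingDist, Finset.card_eq_one]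
  refine ⟨i, ?_⟩
  ext k
  refine Finset.mem_filter.trans ?_
  by_cases hk : k = i
  · subst hk; simp [flipAt]
  · simp [flipAt, hk]

open Classical in
theorem IsComponentCut.card_lower_bound (hn : 6 ≤ n) {F : Finset (Fin n → Bool)}
    (hF : IsComponentCut (foldedHypercube n) (n + 3) F) : (n + 1) * n < 2 * F.card := by
  set G := (foldedHypercube n).induce {v | v ∉ F} with hG
  let l : (Fin n → Bool) → Option G.ConnectedComponent := fun v =>
    if h : v ∉ F then some (G.connectedComponentMk ⟨v, h⟩) else none
  have hsome : ∀ v (h : v ∉ F), l v = some (G.connectedComponentMk ⟨v, h⟩) := fun v h => dif_pos h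
  have hnone : ∀ v, l v = none ↔ v ∈ F := by
    intro v
    by_cases h : v ∈ F <;> simp [l, h]
  have hadj : ∀ u v, (foldedHypercube n).Adj u v → l u = none ∨ l v = none ∨ l u = l v := by
    intro u v huv
    by_cases hu : u ∈ F
    · exact Or.inl ((hnone u).2 hu)
    by_cases hv : v ∈ F
    · exact Or.inr (Or.inl ((hnone v).2 hv))
    refine Or.inr (Or.inr ?_)
    rw [hsome u hu, hsome v hv]
    congr 1
    apply SimpleGraph.ConnectedComponent.sound
    apply SimpleGraph.Adj.reachable
    simpa [hG] using huv
  have hl : FoldedCompat l := by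
    refine ⟨fun v i => hadj _ _ (Or.inl (hypercube_adj_flipAt v i)), fun v => hadj _ _ (Or.inr ?_)⟩
    rw [SimpleGraph.fromRel_adj]
    refine ⟨fun h => ?_, Or.inl rfl⟩
    have := congrFun h ⟨0, by omega⟩
    simp [complementString] at this
  have hd : deleted l = F := by
    ext v
    rw [mem_deleted, hnone]
  have hlab : labels l = Finset.univ := by
    ext c
    simp only [Finset.mem_univ, iff_true, mem_labels]
    induction c using SimpleGraph.ConnectedComponent.ind with
    | h v => exact ⟨v.1, hsome v.1 v.2⟩
  rw [← hd]
  refine hl.lower_bound hn ?_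
  rw [hlab, Finset.card_univ, ← Nat.card_eq_fintype_card]
  exact hF

/-- The complement of an independent set of size at least `g` is a `g`-component cut. -/
lemma isComponentCut_compl {V : Type*} [Fintype V] [DecidableEq V] {G : SimpleGraph V} {g : ℕ}
    {S : Finset V} (hS : g ≤ S.card) (hind : ∀ u ∈ S, ∀ v ∈ S, ¬ G.Adj u v) :
    IsComponentCut G g Sᶜ := by
  have hbot : G.induce {v | v ∉ Sᶜ} = ⊥ := by
    ext u v
    have hu : u.1 ∈ S := by simpa using u.2
    have hv : v.1 ∈ S := by simpa using v.2
    simpa using hind _ hu _ hv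
  rw [IsComponentCut, hbot]
  refine hS.trans ?_
  have hinj : Function.Injective fun v : S =>
      (⊥ : SimpleGraph {v | v ∉ Sᶜ}).connectedComponentMk ⟨v.1, by simp⟩ := by
    intro u v huv
    have := SimpleGraph.ConnectedComponent.exact huv
    rw [SimpleGraph.reachable_bot] at this
    exact Subtype.ext (Subtype.mk.inj this)
  calc S.card = Nat.card S := by simp
    _ ≤ _ := Nat.card_le_card_of_injective _ hinj

/-- The indicator string of a set of positions. -/
def indicatorString (D : Finset (Fin n)) : Fin n → Bool := fun i => decide (i ∈ D)

lemma indicatorString_injective : Function.Injective (indicatorString (n := n)) := by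
  intro D D' h
  ext i
  simpa [indicatorString] using congrFun h i

/-- The strings with exactly two ones are independent: their distances are even, and their
complements have `n - 2 ≠ 2` ones. Existence matters because `sInf ∅ = 0`. -/
lemma exists_isComponentCut (hn : 6 ≤ n) :
    ∃ F, IsComponentCut (foldedHypercube n) (n + 3) F := by
  classical
  refine ⟨_, isComponentCut_compl
    (S := (Finset.powersetCard 2 Finset.univ).image indicatorString) ?_ ?_⟩
  · rw [Finset.card_image_of_injective _ indicatorString_injective, Finset.card_powersetCard,
      Finset.card_univ, Fintype.card_fin, Nat.choose_two_right, Nat.le_div_iff_mul_le two_pos]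
    obtain ⟨k, rfl⟩ := Nat.exists_eq_add_of_le hn
    have : 6 + k - 1 = k + 5 := by omega
    rw [this]
    nlinarith
  · intro u hu v hv huv
    obtain ⟨D, hD, rfl⟩ := Finset.mem_image.1 hu
    obtain ⟨E, hE, rfl⟩ := Finset.mem_image.1 hv
    have cD := (Finset.mem_powersetCard.1 hD).2
    have cE := (Finset.mem_powersetCard.1 hE).2
    have compl : ∀ D E : Finset (Fin n), D.card = 2 → E.card = 2 →
        indicatorString E ≠ complementString (indicatorString D) := by
      intro D E cD cE h
      have hED : E = Dᶜ := by
        ext i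
        have := congrFun h i
        simp only [indicatorString, complementString] at this
        by_cases h₁ : i ∈ D <;> by_cases h₂ : i ∈ E <;> simp_all
      have := Finset.card_compl D
      rw [← hED, Fintype.card_fin] at this
      omega
    rcases huv with h | h
    · have hdist : hammingDist (indicatorString D) (indicatorString E) =
          (D \ E).card + (E \ D).card := by
        rw [← Finset.card_union_of_disjoint disjoint_sdiff_sdiff, hammingDist]
        congr 1
        ext i
        by_cases h₁ : i ∈ D <;> by_cases h₂ : i ∈ E <;> simp [indicatorString, h₁, h₂]
      have h' : hammingDist (indicatorString D) (indicatorString E) = 1 := h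
      have e₁ := Finset.card_sdiff_add_card_inter D E
      have e₂ := Finset.card_sdiff_add_card_inter E D
      rw [Finset.inter_comm] at e₂
      omega
    · rw [SimpleGraph.fromRel_adj] at h
      rcases h.2 with h | h
      · exact compl D E cD cE h
      · exact compl E D cE cD h

end ComponentCuts

theorem mainTheorem3 (n : ℕ) (hn : 6 ≤ n) :
    (componentConnectivity (foldedHypercube n) (n + 3) : ℚ) > fFormula n (n + 2) := by
  obtain ⟨F₀, hF₀⟩ := exists_isComponentCut hn
  obtain ⟨F, hF, hcard⟩ := Nat.sInf_mem (s := {k : ℕ | ∃ F : Finset (Fin n → Bool),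
    IsComponentCut (foldedHypercube n) (n + 3) F ∧ F.card = k}) ⟨_, F₀, hF₀, rfl⟩
  have h := hF.card_lower_bound hn
  have hκ : componentConnectivity (foldedHypercube n) (n + 3) = F.card := hcard.symm
  rw [hκ]
  have h' : ((n : ℚ) + 1) * n < 2 * F.card := by exact_mod_cast h
  unfold fFormula
  push_cast
  nlinarith
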